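/- Let $K$ be an algebraically closed field of any characteristic and let $n,s,t$ be integers with $s\ge 1$, $1\le t\le n$ and $st\le n+1$. Let $L_1,\dots,L_s\subset\mathbb P^n_K$ be general linear subvarieties, each of dimension $t-1$; here it suffices that they are in linearly general position, that is, every subfamily $(L_i)_{i\in S}$ spans a linear subvariety of the largest possible dimension $\min(n+1,|S|t)-1$, a condition that holds on a nonempty Zariski open set of $s$-tuples. Let $X=L_1\cup\dots\cup L_s$ and let $I=I(X)\subset R=K[x_0,\dots,x_n]$ be its homogeneous ideal. For a nonzero homogeneous ideal $I\subset R$ and $m\ge1$, let $I^{(m)}=\bigcap_{P\in\mathrm{Ass}(I)}(I^mR_P\cap R)$ be the $m$-th symbolic power, let $\alpha(I)$ be the least degree of a nonzero homogeneous element of $I$, let $\omega(I)$ be the largest degree of a minimal homogeneous generator of $I$, and put $$\widehat\alpha(I)=\lim_{m\to\infty}\frac{\alpha(I^{(m)})}{m},\qquad \rho(I)=\sup\Big\{\frac mr : m,r\geq 1,\ I^{(m)}\not\subseteq I^r\Big\},\qquad \rho_a(I)=\sup\Big\{\frac mr : m,r\geq 1,\ I^{(mk)}\not\subseteq I^{rk}\text{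 for all } k\gg0\Big\}.$$ Then the limit $\widehat\alpha(I)$ exists and $$\widehat\alpha(I)=\begin{cases}1&\text{if } st<n+1,\\[2pt] \dfrac{n+1}{n+1-t}&\text{if } st=n+1.\end{cases}$$ If $s\ge2$, then $$\rho(I)=\rho_a(I)=\frac{2(s-1)}{s}.$$ Furthermore, $$\frac{\alpha(I)}{\widehat\alpha(I)}=\rho_a(I)=\rho(I)=\frac{\omega(I)}{\widehat\alpha(I)}\quad\text{if } st=n+1,$$ $$\frac{\alpha(I)}{\widehat\alpha(I)}<\rho_a(I)=\rho(I)<\frac{\omega(I)}{\widehat\alpha(I)}\quad\text{if } st\le n\text{ and } s\ge3.$$ -/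

import Mathlib

open Filter Topology MvPolynomial

noncomputable section

namespace LinearUnion

/-! ### Linear subvarieties of projective space -/

/-- The projective space `ℙⁿ` over `K`. -/
abbrev PSpace (K : Type*) [Field K] (n : ℕ) : Type _ :=
  Projectivization K (Fin (n + 1) → K)

/-- Linear subvarieties of `ℙⁿ`. -/
abbrev PLin (K : Type*) [Field K] (n : ℕ) : Type _ :=
  Projectivization.Subspace K (Fin (n + 1) → K)

/-- The vector space dimension of the cone over a linear subvariety, that is, its projective
dimension plus one (so that the empty subvariety has value `0`). -/
def coneDim {K : Type*} [Field K] {n : ℕ} (L : PLin K n) : ℕ :=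
  Module.finrank K (Projectivization.Subspace.submodule L)

/-- The linear subvariety spanned by `t` vectors of `K ^ (n + 1)`. -/
def linearSpan {K : Type*} [Field K] {n t : ℕ} (v : Fin t → Fin (n + 1) → K) : PLin K n :=
  Projectivization.Subspace.submodule.symm (Submodule.span K (Set.range v))

/-- A family of linear subvarieties of `ℙⁿ` is in (linearly) general position if the linear span
of each subfamily has the largest dimension possible. -/
def InGeneralPosition {K : Type*} [Field K] {n s : ℕ} (L : Fin s → PLin K n) : Prop :=
  ∀ S : Finset (Fin s), coneDim (⨆ i ∈ S, L i) = min (n + 1) (∑ i ∈ S, coneDim (L i))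

/-- The union of a family of linear subvarieties. -/
def unionSet {K : Type*} [Field K] {n s : ℕ} (L : Fin s → PLin K n) : Set (PSpace K n) :=
  ⋃ i, (L i : Set (PSpace K n))

/-- The homogeneous ideal `I(X)` of a set `X ⊆ ℙⁿ`: it is generated by the homogeneous polynomials
that vanish at (every representative of) every point of `X`. -/
def projIdeal {K : Type*} [Field K] {n : ℕ} (X : Set (PSpace K n)) :
    Ideal (MvPolynomial (Fin (n + 1)) K) :=
  Ideal.span {f | (∃ d : ℕ, f.IsHomogeneous d) ∧
    ∀ (v : Fin (n + 1) → K) (hv : v ≠ 0), Projectivization.mk K v hv ∈ X → eval v f = 0}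

/-! ### Symbolic powers -/

/-- The `m`-th symbolic power `⋂ (I ^ m R_P ∩ R)`, the intersection being over the associated
primes `P` of `I`. -/
def symbolicPower {R : Type*} [CommRing R] (I : Ideal R) (m : ℕ) : Ideal R :=
  ⨅ (P : Ideal R) (hP : P ∈ Submodule.associatedPrimes I),
    haveI : P.IsPrime := hP.1
    ((I ^ m).map (algebraMap R (Localization.AtPrime P))).comap
      (algebraMap R (Localization.AtPrime P))

/-! ### Degrees, Waldschmidt constant, resurgences -/

section Invariants

variable {K : Type*} [Field K] {σ : Type*}

/-- `α(I)`: the least degree of a nonzero homogeneous element of `I` (for `I ≠ 0` homogeneous). -/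
def initialDegree (I : Ideal (MvPolynomial σ K)) : ℕ :=
  sInf {d : ℕ | ∃ f ∈ I, f ≠ 0 ∧ f.IsHomogeneous d}

/-- `G` is a minimal system of homogeneous generators of `I`. -/
structure IsMinimalGenerators (G : Set (MvPolynomial σ K)) (I : Ideal (MvPolynomial σ K)) :
    Prop where
  homogeneous : ∀ g ∈ G, ∃ d : ℕ, g.IsHomogeneous d
  span_eq : Ideal.span G = I
  minimal : ∀ G' : Set (MvPolynomial σ K), G' ⊂ G → Ideal.span G' ≠ I

/-- `ω(I)`: the largest degree of a minimal generator of `I`. -/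
def maxGeneratorDegree (I : Ideal (MvPolynomial σ K)) : ℕ :=
  sSup {d : ℕ | ∃ G, IsMinimalGenerators G I ∧ ∃ g ∈ G, g.IsHomogeneous d}

/-- The sequence `α(I^(m)) / m`, whose limit is the Waldschmidt constant. -/
def waldschmidtSeq (I : Ideal (MvPolynomial σ K)) (m : ℕ) : ℝ :=
  (initialDegree (symbolicPower I m) : ℝ) / (m : ℝ)

/-- The Waldschmidt constant `lim α(I^(m)) / m`. -/
def waldschmidt (I : Ideal (MvPolynomial σ K)) : ℝ :=
  limUnder atTop (waldschmidtSeq I)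

/-- The resurgence `ρ(I)`. -/
def resurgence (I : Ideal (MvPolynomial σ K)) : ℝ :=
  sSup {q : ℝ | ∃ m r : ℕ, 0 < m ∧ 0 < r ∧ q = (m : ℝ) / (r : ℝ) ∧ ¬ symbolicPower I m ≤ I ^ r}

/-- The asymptotic resurgence `ρ_a(I)`. -/
def asymptoticResurgence (I : Ideal (MvPolynomial σ K)) : ℝ :=
  sSup {q : ℝ | ∃ m r : ℕ, 0 < m ∧ 0 < r ∧ q = (m : ℝ) / (r : ℝ) ∧
    ∀ᶠ t : ℕ in atTop, ¬ symbolicPower I (m * t) ≤ I ^ (r * t)}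

end Invariants

end LinearUnion

end

noncomputable section

namespace LinearUnion

/-! ### Symbolic powers of intersections of primes -/

/-! Since `s * t ≤ n + 1`, general position makes the union of bases of the cones over the `L i`
linearly independent. In suitable coordinates the `L i` are therefore spanned by disjoint blocks of
coordinate vectors, and `I` is a monomial ideal: it is generated by the variables outside all blocks
and by the products of two variables from different blocks. It is the intersection of the primes `P
i` generated by the variables outside block `i`.

Everything then becomes a count of exponents. A monomial lies in the `m`-th symbolic power iff its
degree in the variables outside block `i` (`outWeight`) is at least `m` for every `i`. It lies in `I
^ r` iff these degrees are at least `r` and its `genWeight`, in which variables outside all blocks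
count twice, is at least `2 * r`. Sufficiency is the combinatorial core (`exists_split`,
`monomial_mem_blockIdeal_pow`).

Summing the `s` outside degrees gives `s * m ≤ (s - 1) * genWeight` on the `m`-th symbolic power
(`card_mul_le_genWeight`). If a monomial there misses `I ^ r` with `m ≥ r`, its `genWeight` is below
`2 * r`, so `m / r ≤ 2 * (s - 1) / s`. Powers of a product of one variable per block show sharpness
(`not_blockSymbolic_le`). When the blocks exhaust the variables, `genWeight` is the degree, and the
same inequality and monomials give the Waldschmidt constant `s / (s - 1)`; otherwise powers of a
leftover variable give `1`. -/

theorem mem_symbolicPower {R : Type*} [CommRing R] (I : Ideal R) (m : ℕ) (f : R) :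
    f ∈ symbolicPower I m ↔
      ∀ P ∈ Submodule.associatedPrimes I, ∃ u ∉ P, u * f ∈ I ^ m := by
  simp only [symbolicPower, Submodule.mem_iInf, Ideal.mem_comap]
  refine forall₂_congr fun P hP => ?_
  have : P.IsPrime := hP.1
  rw [IsLocalization.algebraMap_mem_map_algebraMap_iff P.primeCompl]
  rfl

/-- The symbolic powers of `I = ⨅ i, Q i 1` are the intersections of the `Q i m` if the `Q i m`
are saturated with respect to the primes `Q i 1` and agree with `I ^ m` locally at them. -/
theorem symbolicPower_eq_iInf {R B : Type*} [CommRing R] [Finite B] (I : Ideal R)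
    (Q : B → ℕ → Ideal R) (hI : I = ⨅ i, Q i 1) (hprime : ∀ i, (Q i 1).IsPrime)
    (hpow : ∀ i m, I ^ m ≤ Q i m)
    (hsat : ∀ i m x f, x ∉ Q i 1 → x * f ∈ Q i m → f ∈ Q i m)
    (u : B → R) (hu : ∀ i, u i ∉ Q i 1)
    (hloc : ∀ i m f, f ∈ Q i m → u i ^ m * f ∈ I ^ m) (m : ℕ) :
    symbolicPower I m = ⨅ i, Q i m := by
  have := Fintype.ofFinite B
  have hass : ∀ P, P ∈ Submodule.associatedPrimes I ↔ ∃ i, P = Q i 1 := by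
    intro P
    constructor
    · rintro ⟨hP, x, hx⟩
      classical
      -- Multiplying by `x` sends this intersection into `I`, hence it lies in `P`; a prime
      -- containing a finite intersection contains one of its members.
      have hle : (Finset.univ.filter fun i => x ∉ Q i 1).inf (fun i => Q i 1) ≤ P := by
        intro f hf
        rw [hx]
        apply Ideal.le_radical
        rw [Submodule.mem_colon_singleton, smul_eq_mul, hI, Submodule.mem_iInf]
        intro i
        by_cases hi : x ∈ Q i 1
        · exact Ideal.mul_mem_left _ _ hi
        · rw [Submodule.mem_finsetInf] at hf
          exact Ideal.mul_mem_right _ _ (hf i (by simp [hi]))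
      obtain ⟨i, hi, hiP⟩ := (Ideal.IsPrime.inf_le' hP).1 hle
      refine ⟨i, le_antisymm ?_ hiP⟩
      rw [hx, (hprime i).radical_le_iff]
      intro f hf
      rw [Submodule.mem_colon_singleton, smul_eq_mul, hI, Submodule.mem_iInf] at hf
      exact ((hprime i).mem_or_mem (hf i)).resolve_right (by simpa using hi)
    · rintro ⟨i, rfl⟩
      -- The case `m = 1` of `hloc` says that `u i` multiplies `Q i 1` into `I`, so `Q i 1` is the
      -- annihilator of `u i` modulo `I`.
      refine ⟨hprime i, u i, ?_⟩
      have : Submodule.colon I {u i} = Q i 1 := by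
        ext f
        rw [Submodule.mem_colon_singleton, smul_eq_mul]
        constructor
        · intro h
          rw [hI, Submodule.mem_iInf] at h
          exact ((hprime i).mem_or_mem (h i)).resolve_right (hu i)
        · intro h
          have := hloc i 1 f h
          rwa [pow_one, pow_one, mul_comm] at this
      rw [this, (hprime i).radical]
  ext f
  rw [mem_symbolicPower, Submodule.mem_iInf]
  constructor
  · intro h i
    obtain ⟨x, hx, hxf⟩ := h (Q i 1) ((hass _).2 ⟨i, rfl⟩)
    exact hsat i m x f hx (hpow i m hxf)
  · intro h P hP
    obtain ⟨i, rfl⟩ := (hass P).1 hP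
    exact ⟨u i ^ m, fun hmem => hu i ((hprime i).mem_of_pow_mem _ hmem), hloc i m f (h i)⟩

/-! ### Ideals of polynomials of bounded weighted order -/

section Weight

variable {K : Type*} [Field K] {τ : Type*}

/-- The ideal of the polynomials all of whose monomials have weight at least `m`. -/
def weightIdeal (K : Type*) [Field K] {τ : Type*} (w : τ → ℕ) (m : ℕ) :
    Ideal (MvPolynomial τ K) where
  carrier := {f | (m : ℕ∞) ≤ MvPowerSeries.weightedOrder w (f : MvPowerSeries τ K)}
  zero_mem' := by simp
  add_mem' {f g} hf hg := by
    simp only [Set.mem_ofPred_eq, MvPolynomial.coe_add] at *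
    exact (le_min hf hg).trans (MvPowerSeries.min_weightedOrder_le_add w)
  smul_mem' c f hf := by
    simp only [Set.mem_ofPred_eq, smul_eq_mul, MvPolynomial.coe_mul] at *
    rw [MvPowerSeries.weightedOrder_mul]
    exact hf.trans le_add_self

theorem mem_weightIdeal_iff_order {w : τ → ℕ} {m : ℕ} {f : MvPolynomial τ K} :
    f ∈ weightIdeal K w m ↔
      (m : ℕ∞) ≤ MvPowerSeries.weightedOrder w (f : MvPowerSeries τ K) :=
  Iff.rfl

theorem mem_weightIdeal {w : τ → ℕ} {m : ℕ} {f : MvPolynomial τ K} :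
    f ∈ weightIdeal K w m ↔ ∀ a ∈ f.support, m ≤ Finsupp.weight w a := by
  rw [mem_weightIdeal_iff_order]
  constructor
  · intro h a ha
    by_contra! hlt
    have := MvPowerSeries.coeff_eq_zero_of_lt_weightedOrder w (f := (f : MvPowerSeries τ K))
      (d := a) (lt_of_lt_of_le (by exact_mod_cast hlt) h)
    rw [MvPolynomial.coeff_coe] at this
    exact (MvPolynomial.mem_support_iff.1 ha) this
  · intro h
    refine MvPowerSeries.nat_le_weightedOrder w fun a ha => ?_
    rw [MvPolynomial.coeff_coe]
    by_contra hne
    exact absurd (h a (MvPolynomial.mem_support_iff.2 hne)) (by omega)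

theorem monomial_mem_weightIdeal {w : τ → ℕ} {m : ℕ} {a : τ →₀ ℕ} :
    monomial a (1 : K) ∈ weightIdeal K w m ↔ m ≤ Finsupp.weight w a := by
  classical
  rw [mem_weightIdeal, MvPolynomial.support_monomial, if_neg one_ne_zero]
  simp

theorem X_mem_weightIdeal {w : τ → ℕ} {m : ℕ} {k : τ} :
    (X k : MvPolynomial τ K) ∈ weightIdeal K w m ↔ m ≤ w k := by
  rw [X, monomial_mem_weightIdeal]
  simp [Finsupp.weight_apply]

theorem weightIdeal_mul_le (w : τ → ℕ) (a b : ℕ) :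
    weightIdeal K w a * weightIdeal K w b ≤ weightIdeal K w (a + b) := by
  rw [Ideal.mul_le]
  intro f hf g hg
  rw [mem_weightIdeal_iff_order] at *
  rw [MvPolynomial.coe_mul, MvPowerSeries.weightedOrder_mul]
  push_cast
  exact add_le_add hf hg

theorem pow_le_weightIdeal {I : Ideal (MvPolynomial τ K)} {w : τ → ℕ} {c : ℕ}
    (h : I ≤ weightIdeal K w c) (m : ℕ) : I ^ m ≤ weightIdeal K w (c * m) := by
  induction m with
  | zero => intro f _; rw [mem_weightIdeal_iff_order]; simp
  | succ m ih =>
    rw [pow_succ, Nat.mul_succ]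
    exact (Ideal.mul_mono ih h).trans (weightIdeal_mul_le w _ _)

/-- The weighted order of power series over a field is additive on products, and `x` has order `0`.
Primality of the ideal of order at least `1` follows from the same fact. -/
theorem weightIdeal_saturated {w : τ → ℕ} {m : ℕ} {x f : MvPolynomial τ K}
    (hx : x ∉ weightIdeal K w 1) (h : x * f ∈ weightIdeal K w m) : f ∈ weightIdeal K w m := by
  rw [mem_weightIdeal_iff_order] at *
  rw [MvPolynomial.coe_mul, MvPowerSeries.weightedOrder_mul] at h
  have : MvPowerSeries.weightedOrder w (x : MvPowerSeries τ K) = 0 := by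
    rw [not_le, Nat.cast_one] at hx
    exact Order.lt_one_iff.1 hx
  rwa [this, zero_add] at h

theorem weightIdeal_one_isPrime (w : τ → ℕ) : (weightIdeal K w 1).IsPrime where
  ne_top' := by
    rw [Ideal.ne_top_iff_one]
    intro h
    have := (mem_weightIdeal.1 h) 0 (by simp)
    simp at this
  mem_or_mem' {x f} h := by
    by_cases hx : x ∈ weightIdeal K w 1
    · exact Or.inl hx
    · exact Or.inr (weightIdeal_saturated hx h)

theorem mem_of_monomial_mem {I : Ideal (MvPolynomial τ K)} {f : MvPolynomial τ K}
    (h : ∀ a ∈ f.support, monomial a (1 : K) ∈ I) : f ∈ I := by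
  rw [f.as_sum]
  refine Ideal.sum_mem _ fun a ha => ?_
  rw [← mul_one (coeff a f), ← C_mul_monomial]
  exact Ideal.mul_mem_left _ _ (h a ha)

end Weight

/-! ### The ideal of a union of coordinate subspaces in direct sum position

The variables are indexed by `τ`, and `β k` is the block of the variable `k`; variables with
`β k = none` vanish on all of the coordinate subspaces. -/

section Block

variable (K : Type*) [Field K] {τ B : Type*} (β : τ → Option B)

/-- The weight for which the minimal generators of the block ideal have weight `2`. -/
def genWeight (k : τ) : ℕ := if β k = none then 2 else 1

/-- The exponents of the minimal generators of the block ideal. -/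
def genExponents : Set (τ →₀ ℕ) :=
  {a | (∃ k, β k = none ∧ a = Finsupp.single k 1) ∨
    ∃ p q, ∃ i j : B, i ≠ j ∧ β p = some i ∧ β q = some j ∧
      a = Finsupp.single p 1 + Finsupp.single q 1}

/-- The ideal of the union of the coordinate subspaces. -/
def blockIdeal : Ideal (MvPolynomial τ K) :=
  Ideal.span ((fun a => monomial a (1 : K)) '' genExponents β)

variable {K β}

theorem weight_single_one (w : τ → ℕ) (k : τ) : Finsupp.weight w (Finsupp.single k 1) = w k := by
  simp [Finsupp.weight_apply]

theorem genWeight_of_mem {a : τ →₀ ℕ} (ha : a ∈ genExponents β) :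
    Finsupp.weight (genWeight β) a = 2 := by
  rcases ha with ⟨k, hk, rfl⟩ | ⟨p, q, i, j, -, hp, hq, rfl⟩
  · simp [weight_single_one, genWeight, hk]
  · simp [weight_single_one, genWeight, hp, hq]

theorem monomial_mem_blockIdeal {a : τ →₀ ℕ} (ha : a ∈ genExponents β) :
    monomial a (1 : K) ∈ blockIdeal K β :=
  Ideal.subset_span ⟨a, ha, rfl⟩

theorem blockIdeal_le_genWeight : blockIdeal K β ≤ weightIdeal K (genWeight β) 2 := by
  rw [blockIdeal, Ideal.span_le]
  rintro _ ⟨a, ha, rfl⟩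
  exact monomial_mem_weightIdeal.2 (genWeight_of_mem ha).ge

variable [DecidableEq B]

/-- The weight that counts the variables outside of block `i`. -/
def outWeight (β : τ → Option B) (i : B) (k : τ) : ℕ := if β k = some i then 0 else 1

/-- The weight that counts the variables of block `i`. -/
def inWeight (β : τ → Option B) (i : B) (k : τ) : ℕ := if β k = some i then 1 else 0

theorem exists_of_weight_pos {w : τ → ℕ} {a : τ →₀ ℕ} (h : 1 ≤ Finsupp.weight w a) :
    ∃ k, 1 ≤ w k ∧ 1 ≤ a k := by
  by_contra! hc
  have : Finsupp.weight w a = 0 := by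
    rw [Finsupp.weight_apply, Finsupp.sum]
    refine Finset.sum_eq_zero fun k hk => ?_
    have h1 : a k ≠ 0 := Finsupp.mem_support_iff.1 hk
    have : w k = 0 := by
      by_contra h0
      have := hc k (by omega)
      omega
    simp [this]
  omega

theorem weight_le_weight {w w' : τ → ℕ} {a : τ →₀ ℕ} (h : ∀ k ∈ a.support, w k ≤ w' k) :
    Finsupp.weight w a ≤ Finsupp.weight w' a := by
  rw [Finsupp.weight_apply, Finsupp.weight_apply, Finsupp.sum, Finsupp.sum]
  exact Finset.sum_le_sum fun k hk => Nat.mul_le_mul le_rfl (h k hk)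

theorem weight_add_weight (w w' : τ → ℕ) (a : τ →₀ ℕ) :
    Finsupp.weight (w + w') a = Finsupp.weight w a + Finsupp.weight w' a := by
  simp only [Finsupp.weight_apply, Finsupp.sum, Pi.add_apply, smul_add, Finset.sum_add_distrib]

theorem outWeight_of_mem {a : τ →₀ ℕ} (ha : a ∈ genExponents β) (l : B) :
    1 ≤ Finsupp.weight (outWeight β l) a := by
  rcases ha with ⟨k, hk, rfl⟩ | ⟨p, q, i, j, hij, hp, hq, rfl⟩
  · simp [weight_single_one, outWeight, hk]
  · simp only [map_add, weight_single_one, outWeight, hp, hq, Option.some_inj]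
    by_cases h : i = l
    · have : j ≠ l := fun h' => hij (h.trans h'.symm)
      simp [this]
    · simp [h]

/-- A monomial in every `P i` contains some variable. If its block is `i`, membership in `P i`
supplies another variable outside block `i`; the two multiply to a generator, unless one of them is
already a generator. -/
theorem exists_genExponents_le [Nonempty B] {a : τ →₀ ℕ}
    (h : ∀ i, 1 ≤ Finsupp.weight (outWeight β i) a) : ∃ g ∈ genExponents β, g ≤ a := by
  classical
  obtain ⟨k, -, hk⟩ := exists_of_weight_pos (h (Classical.arbitrary B))
  rcases hb : β k with _ | i
  · exact ⟨_, Or.inl ⟨k, hb, rfl⟩, by simpa using hk⟩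
  · obtain ⟨k', hk'i, hk'⟩ := exists_of_weight_pos (h i)
    rcases hb' : β k' with _ | j
    · exact ⟨_, Or.inl ⟨k', hb', rfl⟩, by simpa using hk'⟩
    · have hij : i ≠ j := by
        rintro rfl
        simp [outWeight, hb'] at hk'i
      have hne : k ≠ k' := by
        rintro rfl
        rw [hb] at hb'
        exact hij (Option.some_inj.1 hb')
      refine ⟨_, Or.inr ⟨k, k', i, j, hij, hb, hb', rfl⟩, fun l => ?_⟩
      simp only [Finsupp.add_apply, Finsupp.single_apply]
      split_ifs with h1 h2
      · exact absurd (h1.trans h2.symm) hne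
      · subst h1; omega
      · subst_vars; omega
      · omega

theorem blockIdeal_eq_iInf [Nonempty B] :
    blockIdeal K β = ⨅ i, weightIdeal K (outWeight β i) 1 := by
  apply le_antisymm
  · rw [le_iInf_iff]
    intro i
    rw [blockIdeal, Ideal.span_le]
    rintro _ ⟨a, ha, rfl⟩
    exact monomial_mem_weightIdeal.2 (outWeight_of_mem ha i)
  · intro f hf
    rw [blockIdeal, mem_ideal_span_monomial_image]
    intro a ha
    refine exists_genExponents_le fun i => ?_
    exact mem_weightIdeal.1 ((Submodule.mem_iInf _).1 hf i) a ha

theorem blockIdeal_le_outWeight (i : B) : blockIdeal K β ≤ weightIdeal K (outWeight β i) 1 := by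
  have : Nonempty B := ⟨i⟩
  rw [blockIdeal_eq_iInf]
  exact iInf_le _ i

/-- A divisor of a monomial that is a generator and preserves the conditions for membership in
the powers of the block ideal. -/
theorem exists_split [Fintype B] {r : ℕ} {a : τ →₀ ℕ}
    (hgen : 2 * (r + 1) ≤ Finsupp.weight (genWeight β) a)
    (hout : ∀ i, r + 1 ≤ Finsupp.weight (outWeight β i) a) :
    ∃ g b, g ∈ genExponents β ∧ a = g + b ∧ 2 * r ≤ Finsupp.weight (genWeight β) b ∧
      ∀ i, r ≤ Finsupp.weight (outWeight β i) b := by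
  classical
  -- Removing a variable outside all blocks lowers `genWeight` by `2` and each outside degree by
  -- `1`, exactly what is allowed.
  by_cases hnone : ∃ k, β k = none ∧ 1 ≤ a k
  · obtain ⟨k, hk, hak⟩ := hnone
    obtain ⟨b, rfl⟩ : ∃ b, a = Finsupp.single k 1 + b :=
      ⟨a - Finsupp.single k 1, (add_tsub_cancel_of_le (by simpa using hak)).symm⟩
    refine ⟨_, b, Or.inl ⟨k, hk, rfl⟩, rfl, ?_, fun i => ?_⟩
    · simp only [map_add, weight_single_one, genWeight, hk, if_true] at hgen
      omega
    · have := hout i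
      simp only [map_add, weight_single_one, outWeight, hk] at this
      simp at this
      omega
  · push Not at hnone
    have hsome : ∀ k ∈ a.support, ∃ i, β k = some i := by
      intro k hk
      rw [← Option.ne_none_iff_exists']
      intro h
      have := hnone k h
      have := Finsupp.mem_support_iff.1 hk
      omega
    have htot : ∀ i, Finsupp.weight (outWeight β i) a + Finsupp.weight (inWeight β i) a
        = Finsupp.weight (genWeight β) a := by
      intro i
      rw [← weight_add_weight]
      refine le_antisymm (weight_le_weight ?_) (weight_le_weight ?_) <;>
      · intro k hk
        obtain ⟨j, hj⟩ := hsome k hk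
        simp only [Pi.add_apply, outWeight, inWeight, genWeight, hj]
        split_ifs <;> simp_all
    have hin2 : ∀ i j l : B, i ≠ j → i ≠ l → j ≠ l → Finsupp.weight (inWeight β i) a +
        Finsupp.weight (inWeight β j) a ≤ Finsupp.weight (outWeight β l) a := by
      intro i j l hij hil hjl
      rw [← weight_add_weight]
      refine weight_le_weight fun k hk => ?_
      obtain ⟨m, hm⟩ := hsome k hk
      simp only [Pi.add_apply, outWeight, inWeight, hm, Option.some_inj]
      split_ifs <;> simp_all
    obtain ⟨k0, hk0, hak0⟩ := exists_of_weight_pos (w := genWeight β) (a := a) (by omega)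
    obtain ⟨i0, -⟩ := hsome k0 (Finsupp.mem_support_iff.2 (by omega))
    -- Greedy choice: remove one variable from each of the two blocks `i`, `j` of largest degree in
    -- `a`.
    obtain ⟨i, -, hi⟩ := Finset.exists_max_image Finset.univ
      (fun i => Finsupp.weight (inWeight β i) a) ⟨i0, Finset.mem_univ _⟩
    obtain ⟨k1, hk1, hak1⟩ := exists_of_weight_pos (w := outWeight β i) (a := a)
      (by have := hout i; omega)
    obtain ⟨j1, hj1⟩ := hsome k1 (Finsupp.mem_support_iff.2 (by omega))
    have hj1i : j1 ≠ i := by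
      rintro rfl
      simp [outWeight, hj1] at hk1
    obtain ⟨j, hji, hj⟩ := Finset.exists_max_image (Finset.univ.erase i)
      (fun i => Finsupp.weight (inWeight β i) a) ⟨j1, by simp [hj1i]⟩
    replace hji : j ≠ i := by simpa using hji
    have hle : ∀ k : τ, ∀ l, β k = some l → 1 ≤ a k → 1 ≤ Finsupp.weight (inWeight β l) a := by
      intro k l hkl hk
      have : Finsupp.single k 1 ≤ a := by simpa using hk
      obtain ⟨c, rfl⟩ := exists_add_of_le this
      simp [weight_single_one, inWeight, hkl]
    have hjpos : 1 ≤ Finsupp.weight (inWeight β j) a :=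
      (hle k1 j1 hj1 hak1).trans (hj j1 (by simp [hj1i]))
    have hipos : 1 ≤ Finsupp.weight (inWeight β i) a :=
      hjpos.trans (hi j (Finset.mem_univ _))
    obtain ⟨p, hp, hap⟩ := exists_of_weight_pos hipos
    obtain ⟨q, hq, haq⟩ := exists_of_weight_pos hjpos
    replace hp : β p = some i := by
      by_contra h
      simp [inWeight, h] at hp
    replace hq : β q = some j := by
      by_contra h
      simp [inWeight, h] at hq
    have hpq : p ≠ q := by
      rintro rfl
      rw [hp] at hq
      exact hji (Option.some_inj.1 hq).symm
    have hga : Finsupp.single p 1 + Finsupp.single q 1 ≤ a := by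
      intro l
      simp only [Finsupp.add_apply, Finsupp.single_apply]
      split_ifs with h1 h2
      · exact absurd (h1.trans h2.symm) hpq
      · subst h1; omega
      · subst_vars; omega
      · omega
    obtain ⟨b, hb⟩ := exists_add_of_le hga
    refine ⟨_, b, Or.inr ⟨p, q, i, j, hji.symm, hp, hq, rfl⟩, hb, ?_, fun l => ?_⟩
    · have : Finsupp.weight (genWeight β) a = 2 + Finsupp.weight (genWeight β) b := by
        rw [hb]
        simp [weight_single_one, genWeight, hp, hq]
      omega
    · have hl : Finsupp.weight (outWeight β l) a = (outWeight β l p + outWeight β l q)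
          + Finsupp.weight (outWeight β l) b := by
        rw [hb]
        simp only [map_add, weight_single_one]
      have hol := hout l
      by_cases hil : i = l
      · subst hil
        have h1 : outWeight β i p = 0 := by simp [outWeight, hp]
        have h2 : outWeight β i q = 1 := by simp [outWeight, hq, hji]
        omega
      · have h1 : outWeight β l p = 1 := by simp [outWeight, hp, hil]
        by_cases hjl : j = l
        · subst hjl
          have h2 : outWeight β j q = 0 := by simp [outWeight, hq]
          omega
        · have h2 : outWeight β l q = 1 := by simp [outWeight, hq, hjl]
          -- Here the outside degree of `l` drops by `2`, so it must be at least `r + 2`. Otherwise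
          -- `htot` makes the degree in block `l` at least `r + 1`. Blocks `i` and `j` are no
          -- smaller, so the outside degree would be at least `2 * (r + 1)`.
          have h3 := hin2 i j l hji.symm hil hjl
          have h4 := htot l
          have h5 := hj l (by simp [Ne.symm hil])
          have h6 := hi l (Finset.mem_univ _)
          omega

/-- Induction on `r`, splitting off one generator at a time without losing the inequalities for the
quotient. -/
theorem monomial_mem_blockIdeal_pow [Fintype B] : ∀ {r : ℕ} {a : τ →₀ ℕ},
    2 * r ≤ Finsupp.weight (genWeight β) a →
    (∀ i, r ≤ Finsupp.weight (outWeight β i) a) → monomial a (1 : K) ∈ blockIdeal K β ^ r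
  | 0, _, _, _ => by simp
  | r + 1, a, hgen, hout => by
    obtain ⟨g, b, hg, rfl, h1, h2⟩ := exists_split hgen hout
    rw [pow_succ', ← mul_one (1 : K), ← monomial_mul]
    exact Ideal.mul_mem_mul (monomial_mem_blockIdeal hg) (monomial_mem_blockIdeal_pow h1 h2)

/-- The factor `X p ^ m` raises `genWeight` and every outside degree except that of `i` by `m`. This
makes `X p` a witness that `I ^ m` and `P i ^ m` agree locally at `P i`. -/
theorem mul_mem_blockIdeal_pow [Fintype B] {i : B} {p : τ} (hp : β p = some i) {m : ℕ}
    {f : MvPolynomial τ K} (hf : f ∈ weightIdeal K (outWeight β i) m) :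
    X p ^ m * f ∈ blockIdeal K β ^ m := by
  rw [f.as_sum, Finset.mul_sum]
  refine Ideal.sum_mem _ fun a ha => ?_
  rw [← mul_one (coeff a f), ← C_mul_monomial, mul_left_comm]
  refine Ideal.mul_mem_left _ _ ?_
  rw [X_pow_eq_monomial, monomial_mul, mul_one]
  have h := mem_weightIdeal.1 hf a ha
  have hs : ∀ w : τ → ℕ, Finsupp.weight w (Finsupp.single p m) = m * w p := by
    intro w
    simp [Finsupp.weight_apply]
  refine monomial_mem_blockIdeal_pow ?_ fun l => ?_
  · have h1 : Finsupp.weight (outWeight β i) a ≤ Finsupp.weight (genWeight β) a := by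
      refine weight_le_weight fun k _ => ?_
      simp only [outWeight, genWeight]
      split_ifs <;> simp
    rw [map_add, hs, genWeight, hp]
    simp
    omega
  · rw [map_add, hs]
    by_cases hil : i = l
    · subst hil
      exact h.trans le_add_self
    · simp [outWeight, hp, hil]

/-- The inequality behind the values of the Waldschmidt constant and of the resurgence. -/
theorem card_mul_le_genWeight [Fintype B] (hB : 2 ≤ Fintype.card B) {m : ℕ} {a : τ →₀ ℕ}
    (h : ∀ i, m ≤ Finsupp.weight (outWeight β i) a) :
    Fintype.card B * m ≤ (Fintype.card B - 1) * Finsupp.weight (genWeight β) a := by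
  have h1 : Fintype.card B * m ≤ ∑ i, Finsupp.weight (outWeight β i) a := by
    have := Finset.sum_le_sum (s := Finset.univ) fun i _ => h i
    simpa using this
  refine h1.trans ?_
  simp only [Finsupp.weight_apply, Finsupp.sum]
  rw [Finset.sum_comm, Finset.mul_sum]
  refine Finset.sum_le_sum fun k _ => ?_
  simp only [smul_eq_mul]
  rw [← Finset.mul_sum, mul_left_comm]
  refine Nat.mul_le_mul le_rfl ?_
  -- A variable in a block is counted `card B - 1` times. One outside all blocks is counted `card B`
  -- times, which its weight `2` covers because `card B ≤ 2 * (card B - 1)`.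
  rcases hb : β k with _ | j
  · simp [outWeight, genWeight, hb]
    omega
  · simp only [outWeight, genWeight, hb, Option.some_inj, reduceCtorEq, if_false, mul_one]
    rw [← Finset.sum_erase_add _ _ (Finset.mem_univ j), if_pos rfl, add_zero]
    refine (Finset.sum_le_card_nsmul _ _ 1 fun i _ => by split_ifs <;> simp).trans ?_
    simp

end Block

/-! ### Invariants under graded isomorphisms -/

section Transport

variable {K : Type*} [Field K] {σ τ : Type*} (e : MvPolynomial σ K ≃ₐ[K] MvPolynomial τ K)

theorem comap_pow_algEquiv (J : Ideal (MvPolynomial τ K)) (r : ℕ) :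
    (J ^ r).comap e = (J.comap e) ^ r := by
  have h : ∀ I : Ideal (MvPolynomial τ K), I.comap e = I.map e.symm := fun I =>
    Ideal.comap_symm (I := I) e.toRingEquiv.symm
  rw [h, h, Ideal.map_pow]

theorem comap_le_comap_algEquiv {I J : Ideal (MvPolynomial τ K)} :
    I.comap e ≤ J.comap e ↔ I ≤ J :=
  Ideal.comap_le_comap_iff_of_surjective e e.surjective I J

variable {e}

theorem initialDegree_comap (he : ∀ f d, (e f).IsHomogeneous d ↔ f.IsHomogeneous d)
    (J : Ideal (MvPolynomial τ K)) :
    initialDegree (J.comap e) = initialDegree J := by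
  unfold initialDegree
  congr 1
  ext d
  constructor
  · rintro ⟨f, hf, hne, hd⟩
    exact ⟨e f, hf, by simpa using hne, (he f d).2 hd⟩
  · rintro ⟨f, hf, hne, hd⟩
    refine ⟨e.symm f, by simpa [Ideal.mem_comap] using hf, by simpa using hne, ?_⟩
    rw [← he]
    simpa using hd

theorem isMinimalGenerators_image
    (he : ∀ f d, (e f).IsHomogeneous d ↔ f.IsHomogeneous d)
    {G : Set (MvPolynomial σ K)} {J : Ideal (MvPolynomial τ K)} :
    IsMinimalGenerators (e '' G) J ↔ IsMinimalGenerators G (J.comap e) := by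
  have hspan : ∀ G' : Set (MvPolynomial σ K),
      Ideal.span (e '' G') = J ↔ Ideal.span G' = J.comap e := by
    intro G'
    rw [← Ideal.map_span]
    constructor
    · rintro rfl
      exact (Ideal.comap_map_of_bijective e e.bijective).symm
    · intro h
      rw [h, Ideal.map_comap_of_surjective e e.surjective]
  constructor
  · intro h
    refine ⟨fun g hg => ?_, (hspan G).1 h.span_eq, fun G' hG' h' => ?_⟩
    · obtain ⟨d, hd⟩ := h.homogeneous (e g) ⟨g, hg, rfl⟩
      exact ⟨d, (he g d).1 hd⟩
    · exact h.minimal _ ((e.injective.image_strictMono hG')) ((hspan G').2 h')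
  · intro h
    refine ⟨?_, (hspan G).2 h.span_eq, fun G' hG' h' => ?_⟩
    · rintro _ ⟨g, hg, rfl⟩
      obtain ⟨d, hd⟩ := h.homogeneous g hg
      exact ⟨d, (he g d).2 hd⟩
    · have hG : G' = e '' (e ⁻¹' G') := (Set.image_preimage_eq _ e.surjective).symm
      rw [hG] at hG' h'
      exact h.minimal _ ((e.injective.injOn.image_ssubset_image_iff (Set.subset_univ _)
        (Set.subset_univ _)).1 hG') ((hspan _).1 h')

theorem maxGeneratorDegree_comap (he : ∀ f d, (e f).IsHomogeneous d ↔ f.IsHomogeneous d)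
    (J : Ideal (MvPolynomial τ K)) :
    maxGeneratorDegree (J.comap e) = maxGeneratorDegree J := by
  unfold maxGeneratorDegree
  congr 1
  ext d
  constructor
  · rintro ⟨G, hG, g, hg, hd⟩
    exact ⟨e '' G, (isMinimalGenerators_image he).2 hG, e g, ⟨g, hg, rfl⟩, (he g d).2 hd⟩
  · rintro ⟨G, hG, g, hg, hd⟩
    have hG' : G = e '' (e ⁻¹' G) := (Set.image_preimage_eq _ e.surjective).symm
    refine ⟨e ⁻¹' G, (isMinimalGenerators_image he).1 (hG' ▸ hG), e.symm g, by simpa using hg, ?_⟩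
    rw [← he]
    simpa using hd

end Transport

/-! ### Degrees of minimal generators -/

/-- A generator `g` of degree above `N` would be redundant: write an element of `T` of degree `k ≤
N` as `a * g + z` and take components of degree `k`. The first summand contributes nothing, and the
rest stays in the homogeneous ideal generated by `G \ {g}`. -/
theorem degree_le_of_isMinimalGenerators {K σ : Type*} [Field K] {G T : Set (MvPolynomial σ K)}
    {J : Ideal (MvPolynomial σ K)} {N : ℕ} (hT : Ideal.span T = J)
    (hTd : ∀ f ∈ T, ∃ d ≤ N, f.IsHomogeneous d) (hG : IsMinimalGenerators G J)
    {g : MvPolynomial σ K} (hg : g ∈ G) {d : ℕ} (hd : g.IsHomogeneous d) : d ≤ N := by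
  classical
  by_contra! hlt
  refine hG.minimal (G \ {g}) ⟨Set.sdiff_subset, fun h => (h hg).2 rfl⟩ (le_antisymm ?_ ?_)
  · rw [← hG.span_eq]
    exact Ideal.span_mono Set.sdiff_subset
  · rw [← hT, Ideal.span_le]
    intro f hf
    obtain ⟨k, hk, hfk⟩ := hTd f hf
    have hmem : f ∈ Ideal.span (insert g (G \ {g})) := by
      rw [Set.insert_sdiff_singleton, Set.insert_eq_of_mem hg, hG.span_eq, ← hT]
      exact Ideal.subset_span hf
    obtain ⟨a, z, hz, hfz⟩ := Ideal.mem_span_insert.1 hmem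
    let _ := gradedAlgebra (σ := σ) (R := K)
    have hhom : (Ideal.span (G \ {g})).IsHomogeneous (homogeneousSubmodule σ K) := by
      refine Ideal.homogeneous_span _ _ fun x hx => ?_
      obtain ⟨c, hc⟩ := hG.homogeneous x hx.1
      exact ⟨c, hc⟩
    have hzk : homogeneousComponent k z ∈ Ideal.span (G \ {g}) := by
      rw [← decomposition.decompose'_apply]
      exact hhom k hz
    have hag : homogeneousComponent k (a * g) = 0 := by
      ext c
      rw [coeff_homogeneousComponent, coeff_zero]
      split_ifs with hc
      · have hgw : g ∈ weightIdeal K (1 : σ → ℕ) d :=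
          mem_weightIdeal.2 fun b hb => (hd (mem_support_iff.1 hb)).ge
        by_contra hne
        have := mem_weightIdeal.1 (Ideal.mul_mem_left _ a hgw) c (mem_support_iff.2 hne)
        have hdeg : Finsupp.weight (1 : σ → ℕ) c = c.degree := by
          rw [Finsupp.degree_eq_weight_one]; rfl
        omega
      · rfl
    have hcomp : homogeneousComponent k f = f := by
      rw [homogeneousComponent_of_mem (n := k) hfk, if_pos rfl]
    rw [SetLike.mem_coe, ← hcomp, hfz, map_add, hag, zero_add]
    exact hzk

/-! ### The invariants of the block ideal -/

section Invariants

variable {K : Type*} [Field K] {τ B : Type*} {β : τ → Option B}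

theorem isHomogeneous_of_mem_genExponents {a : τ →₀ ℕ} (ha : a ∈ genExponents β) :
    ∃ d ≤ 2, (monomial a (1 : K)).IsHomogeneous d := by
  rcases ha with ⟨k, hk, rfl⟩ | ⟨p, q, i, j, -, hp, hq, rfl⟩
  · exact ⟨1, by norm_num, isHomogeneous_monomial _ (by simp)⟩
  · exact ⟨2, le_rfl, isHomogeneous_monomial _ (by simp)⟩

/-- All generators have `genWeight` equal to `2` and every variable has positive weight, so none
divides another properly. -/
theorem eq_of_le_of_mem_genExponents {a b : τ →₀ ℕ} (ha : a ∈ genExponents β)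
    (hb : b ∈ genExponents β) (hab : a ≤ b) : a = b := by
  obtain ⟨c, rfl⟩ := exists_add_of_le hab
  have h1 := genWeight_of_mem ha
  have h2 := genWeight_of_mem hb
  rw [map_add, h1] at h2
  suffices c = 0 by rw [this, add_zero]
  ext k
  by_contra hk
  have hk' : Finsupp.single k 1 ≤ c := by
    simpa using Nat.one_le_iff_ne_zero.2 hk
  obtain ⟨c', rfl⟩ := exists_add_of_le hk'
  rw [map_add, weight_single_one] at h2
  have : 1 ≤ genWeight β k := by
    unfold genWeight
    split_ifs <;> simp
  omega

theorem isMinimalGenerators_blockIdeal :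
    IsMinimalGenerators ((fun a => monomial a (1 : K)) '' genExponents β) (blockIdeal K β) where
  homogeneous := by
    rintro _ ⟨a, ha, rfl⟩
    obtain ⟨d, -, hd⟩ := isHomogeneous_of_mem_genExponents (K := K) ha
    exact ⟨d, hd⟩
  span_eq := rfl
  minimal G' hG' h := by
    classical
    obtain ⟨_, ⟨a, ha, rfl⟩, hna⟩ := Set.exists_of_ssubset hG'
    have hsub : G' ⊆ (fun a => monomial a (1 : K)) '' (genExponents β \ {a}) := by
      intro g hg
      obtain ⟨b, hb, rfl⟩ := hG'.1 hg
      refine ⟨b, ⟨hb, ?_⟩, rfl⟩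
      rintro rfl
      exact hna hg
    have hmem : monomial a (1 : K) ∈ Ideal.span G' := h ▸ monomial_mem_blockIdeal ha
    obtain ⟨b, hb, hba⟩ := mem_ideal_span_monomial_image.1 (Ideal.span_mono hsub hmem) a
      (by rw [mem_support_iff, coeff_monomial, if_pos rfl]; exact one_ne_zero)
    exact hb.2 (eq_of_le_of_mem_genExponents hb.1 ha hba)

theorem maxGeneratorDegree_blockIdeal (hβ : ∃ p q i j, i ≠ j ∧ β p = some i ∧ β q = some j) :
    maxGeneratorDegree (blockIdeal K β) = 2 := by
  have hle : ∀ d ∈ {d : ℕ | ∃ G, IsMinimalGenerators G (blockIdeal K β) ∧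
      ∃ g ∈ G, g.IsHomogeneous d}, d ≤ 2 := by
    rintro d ⟨G, hG, g, hg, hd⟩
    refine degree_le_of_isMinimalGenerators rfl ?_ hG hg hd
    rintro _ ⟨a, ha, rfl⟩
    exact isHomogeneous_of_mem_genExponents ha
  have hmem : 2 ∈ {d : ℕ | ∃ G, IsMinimalGenerators G (blockIdeal K β) ∧
      ∃ g ∈ G, g.IsHomogeneous d} := by
    obtain ⟨p, q, i, j, hij, hp, hq⟩ := hβ
    refine ⟨_, isMinimalGenerators_blockIdeal, _,
      ⟨_, Or.inr ⟨p, q, i, j, hij, hp, hq, rfl⟩, rfl⟩, isHomogeneous_monomial _ (by simp)⟩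
  exact le_antisymm (csSup_le ⟨2, hmem⟩ hle) (le_csSup ⟨2, hle⟩ hmem)

/-- The degree of a form is the degree of each of its monomials. -/
theorem exists_mem_support_weight {f : MvPolynomial τ K} {d : ℕ} (hne : f ≠ 0)
    (hd : f.IsHomogeneous d) : ∃ a ∈ f.support, Finsupp.weight (1 : τ → ℕ) a = d := by
  obtain ⟨a, ha⟩ := support_nonempty.2 hne
  exact ⟨a, ha, hd (mem_support_iff.1 ha)⟩

theorem genWeight_eq_one (hβ : ∀ k, β k ≠ none) : genWeight β = 1 := by
  ext k
  simp [genWeight, hβ k]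

theorem weight_sum_single [Fintype B] (w : τ → ℕ) (p : B → τ) (c : ℕ) :
    Finsupp.weight w (∑ i, Finsupp.single (p i) c) = ∑ i, c * w (p i) := by
  rw [map_sum]
  exact Finset.sum_congr rfl fun i _ => by simp [Finsupp.weight_apply]

variable [DecidableEq B]

/-- The symbolic powers of the block ideal. -/
def blockSymbolic (K : Type*) [Field K] (β : τ → Option B) (m : ℕ) : Ideal (MvPolynomial τ K) :=
  ⨅ i, weightIdeal K (outWeight β i) m

theorem mem_blockSymbolic {m : ℕ} {f : MvPolynomial τ K} :
    f ∈ blockSymbolic K β m ↔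
      ∀ a ∈ f.support, ∀ i, m ≤ Finsupp.weight (outWeight β i) a := by
  simp only [blockSymbolic, Submodule.mem_iInf, mem_weightIdeal]
  exact ⟨fun h a ha i => h i a ha, fun h i a ha => h a ha i⟩

theorem monomial_mem_blockSymbolic {m : ℕ} {a : τ →₀ ℕ} :
    monomial a (1 : K) ∈ blockSymbolic K β m ↔
      ∀ i, m ≤ Finsupp.weight (outWeight β i) a := by
  simp only [blockSymbolic, Submodule.mem_iInf, monomial_mem_weightIdeal]

theorem blockSymbolic_one [Nonempty B] : blockSymbolic K β 1 = blockIdeal K β :=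
  blockIdeal_eq_iInf.symm

theorem initialDegree_blockSymbolic_of_none [Nonempty B] (hβ : ∃ k, β k = none) (m : ℕ) :
    initialDegree (blockSymbolic K β m) = m := by
  have hmem : m ∈ {d : ℕ | ∃ f ∈ blockSymbolic K β m, f ≠ 0 ∧ f.IsHomogeneous d} := by
    obtain ⟨k, hk⟩ := hβ
    refine ⟨monomial (Finsupp.single k m) 1, ?_, by simp, isHomogeneous_monomial _ (by simp)⟩
    rw [monomial_mem_blockSymbolic]
    intro i
    simp [Finsupp.weight_apply, outWeight, hk]
  refine le_antisymm (Nat.sInf_le hmem) (le_csInf ⟨m, hmem⟩ ?_)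
  rintro d ⟨f, hf, hne, hd⟩
  obtain ⟨a, ha, rfl⟩ := exists_mem_support_weight hne hd
  refine (mem_blockSymbolic.1 hf a ha (Classical.arbitrary B)).trans
    (weight_le_weight fun k _ => ?_)
  simp only [outWeight, Pi.one_apply]
  split_ifs <;> simp

variable [Fintype B]

/-- The general criterion is applied to the pulled back ideals themselves, so localizations need not
be transported along `e`. A variable of block `i` serves as `u i`. -/
theorem symbolicPower_comap_blockIdeal [Nonempty B] (hβ : ∀ i, ∃ p, β p = some i) {σ : Type*}
    (e : MvPolynomial σ K ≃ₐ[K] MvPolynomial τ K) (m : ℕ) :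
    symbolicPower ((blockIdeal K β).comap e) m = (blockSymbolic K β m).comap e := by
  choose p hp using hβ
  rw [blockSymbolic, Ideal.comap_iInf]
  refine symbolicPower_eq_iInf _ (fun i m => (weightIdeal K (outWeight β i) m).comap e) ?_ ?_ ?_ ?_
    (fun i => e.symm (X (p i))) ?_ ?_ m
  · rw [blockIdeal_eq_iInf, Ideal.comap_iInf]
  · intro i
    have := weightIdeal_one_isPrime (K := K) (outWeight β i)
    exact Ideal.comap_isPrime _ _
  · intro i m
    rw [← comap_pow_algEquiv, comap_le_comap_algEquiv]
    simpa using pow_le_weightIdeal (blockIdeal_le_outWeight (K := K) i) m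
  · intro i m x f hx hf
    rw [Ideal.mem_comap] at *
    rw [map_mul] at hf
    exact weightIdeal_saturated hx hf
  · intro i
    simp [Ideal.mem_comap, X_mem_weightIdeal, outWeight, hp]
  · intro i m f hf
    rw [← comap_pow_algEquiv, Ideal.mem_comap, map_mul, map_pow, AlgEquiv.apply_symm_apply]
    exact mul_mem_blockIdeal_pow (hp i) hf

theorem card_mul_le_of_not_blockSymbolic_le (hB : 2 ≤ Fintype.card B) {m r : ℕ}
    (h : ¬ blockSymbolic K β m ≤ blockIdeal K β ^ r) :
    Fintype.card B * m ≤ 2 * (Fintype.card B - 1) * r := by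
  rcases lt_or_ge m r with hmr | hmr
  · exact Nat.mul_le_mul (by omega) hmr.le
  · rw [SetLike.not_le_iff_exists] at h
    obtain ⟨f, hf, hnf⟩ := h
    by_contra hlt
    refine hnf (mem_of_monomial_mem fun a ha => ?_)
    have hout := mem_blockSymbolic.1 hf a ha
    refine monomial_mem_blockIdeal_pow ?_ fun i => hmr.trans (hout i)
    by_contra! hgen
    refine hlt ((card_mul_le_genWeight hB hout).trans ?_)
    rw [mul_comm 2, mul_assoc]
    exact Nat.mul_le_mul le_rfl hgen.le

theorem outWeight_sum_single {p : B → τ} (hp : ∀ i, β (p i) = some i) (c : ℕ) (i : B) :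
    Finsupp.weight (outWeight β i) (∑ i, Finsupp.single (p i) c) = (Fintype.card B - 1) * c := by
  rw [weight_sum_single, ← Finset.sum_erase_add _ _ (Finset.mem_univ i)]
  have : ∀ j ∈ Finset.univ.erase i, c * outWeight β i (p j) = c := by
    intro j hj
    simp [outWeight, hp, (Finset.mem_erase.1 hj).1]
  rw [Finset.sum_congr rfl this]
  simp [outWeight, hp]

/-- The witness is the product of one variable per block, raised to `2 * j * k`. Its outside degrees
are exactly the required ones, while its `genWeight` falls short of `2 * (card B * j + 1) * k` by `2
* k`. The factor `k` serves the asymptotic resurgence. -/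
theorem not_blockSymbolic_le (hβ : ∀ i, ∃ p, β p = some i) (j : ℕ) {k : ℕ} (hk : 0 < k) :
    ¬ blockSymbolic K β (2 * (Fintype.card B - 1) * j * k) ≤
      blockIdeal K β ^ ((Fintype.card B * j + 1) * k) := by
  choose p hp using hβ
  intro h
  have hmem : monomial (∑ i, Finsupp.single (p i) (2 * j * k)) (1 : K) ∈
      blockSymbolic K β (2 * (Fintype.card B - 1) * j * k) := by
    rw [monomial_mem_blockSymbolic]
    intro i
    rw [outWeight_sum_single hp]
    exact le_of_eq (by ring)
  have hgen := monomial_mem_weightIdeal.1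
    (pow_le_weightIdeal blockIdeal_le_genWeight _ (h hmem))
  rw [weight_sum_single] at hgen
  simp only [genWeight, hp, reduceCtorEq, if_false, mul_one, Finset.sum_const, Finset.card_univ,
    smul_eq_mul] at hgen
  nlinarith

theorem card_mul_le_initialDegree_blockSymbolic (hB : 2 ≤ Fintype.card B)
    (hβ : ∀ i, ∃ p, β p = some i) (hnone : ∀ k, β k ≠ none) (m : ℕ) :
    Fintype.card B * m ≤ (Fintype.card B - 1) * initialDegree (blockSymbolic K β m) := by
  -- The infimum of the empty set would be `0`; nonemptiness makes the initial degree attained by a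
  -- form.
  have hne : {d : ℕ | ∃ f ∈ blockSymbolic K β m, f ≠ 0 ∧ f.IsHomogeneous d}.Nonempty := by
    choose p hp using hβ
    refine ⟨_, monomial (∑ i, Finsupp.single (p i) m) 1, ?_, by simp,
      isHomogeneous_monomial _ rfl⟩
    rw [monomial_mem_blockSymbolic]
    intro i
    rw [outWeight_sum_single hp]
    exact Nat.le_mul_of_pos_left _ (by omega)
  obtain ⟨f, hf, hne, hd⟩ := Nat.sInf_mem hne
  obtain ⟨a, ha, hda⟩ := exists_mem_support_weight hne hd
  have := card_mul_le_genWeight hB (mem_blockSymbolic.1 hf a ha)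
  rwa [genWeight_eq_one hnone, hda] at this

theorem initialDegree_blockSymbolic_le (hβ : ∀ i, ∃ p, β p = some i) {m c : ℕ}
    (hc : m ≤ (Fintype.card B - 1) * c) :
    initialDegree (blockSymbolic K β m) ≤ Fintype.card B * c := by
  choose p hp using hβ
  refine Nat.sInf_le ⟨monomial (∑ i, Finsupp.single (p i) c) 1, ?_, by simp,
      isHomogeneous_monomial _ ?_⟩
  · rw [monomial_mem_blockSymbolic]
    intro i
    rwa [outWeight_sum_single hp]
  · rw [Finsupp.degree_eq_weight_one, weight_sum_single]
    simp

theorem initialDegree_blockIdeal (hB : 2 ≤ Fintype.card B)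
    (hβ : ∀ i, ∃ p, β p = some i) (hnone : ∀ k, β k ≠ none) :
    initialDegree (blockIdeal K β) = 2 := by
  have : Nonempty B := Fintype.card_pos_iff.1 (by omega)
  apply le_antisymm
  · have := hβ
    choose p hp using hβ
    obtain ⟨i, j, hij⟩ := Fintype.one_lt_card_iff.1 hB
    exact Nat.sInf_le ⟨_, monomial_mem_blockIdeal (Or.inr ⟨p i, p j, i, j, hij, hp i, hp j, rfl⟩),
      by simp, isHomogeneous_monomial _ (by simp)⟩
  · rw [← blockSymbolic_one]
    have := card_mul_le_initialDegree_blockSymbolic (K := K) hB hβ hnone 1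
    by_contra! hlt
    have h1 : initialDegree (blockSymbolic K β 1) ≤ 1 := by omega
    have h2 := Nat.mul_le_mul (le_refl (Fintype.card B - 1)) h1
    omega

end Invariants

/-! ### Linear substitutions -/

section LinearSubst

variable {K : Type*} [Field K] {σ τ : Type*}

/-- The linear forms whose coefficients are the rows of a matrix. -/
def rowForm [Fintype τ] (M : Matrix σ τ K) (a : σ) : MvPolynomial τ K :=
  ∑ k, C (M a k) * X k

theorem isHomogeneous_rowForm [Fintype τ] (M : Matrix σ τ K) (a : σ) :
    (rowForm M a).IsHomogeneous 1 :=
  IsHomogeneous.sum _ _ _ fun k _ => by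
    simpa using (isHomogeneous_C τ (M a k)).mul (isHomogeneous_X K k)

theorem aeval_rowForm_comp [Fintype σ] [Fintype τ] [DecidableEq σ] {M : Matrix σ τ K}
    {N : Matrix τ σ K} (h : M * N = 1) :
    (aeval (rowForm N)).comp (aeval (rowForm M)) = AlgHom.id K (MvPolynomial σ K) := by
  ext1 a
  have hMN : ∀ b, ∑ k, M a k * N k b = if a = b then 1 else 0 := by
    intro b
    rw [← Matrix.mul_apply, h, Matrix.one_apply]
  simp only [AlgHom.comp_apply, aeval_X, AlgHom.id_apply, rowForm, map_sum, map_mul, aeval_C,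
    algebraMap_eq, Finset.mul_sum]
  rw [Finset.sum_comm]
  simp_rw [← mul_assoc, ← Finset.sum_mul, ← C_mul, ← map_sum, hMN]
  simp

/-- The linear change of coordinates given by a pair of mutually inverse matrices. -/
def linearSubst [Fintype σ] [Fintype τ] [DecidableEq σ] [DecidableEq τ] (M : Matrix σ τ K)
    (N : Matrix τ σ K) (hMN : M * N = 1) (hNM : N * M = 1) :
    MvPolynomial σ K ≃ₐ[K] MvPolynomial τ K :=
  AlgEquiv.ofAlgHom (aeval (rowForm M)) (aeval (rowForm N)) (aeval_rowForm_comp hNM)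
    (aeval_rowForm_comp hMN)

variable [Fintype σ] [Fintype τ] [DecidableEq σ] [DecidableEq τ] {M : Matrix σ τ K}
  {N : Matrix τ σ K} (hMN : M * N = 1) (hNM : N * M = 1)

theorem isHomogeneous_linearSubst (f : MvPolynomial σ K) (d : ℕ) :
    (linearSubst M N hMN hNM f).IsHomogeneous d ↔ f.IsHomogeneous d := by
  constructor
  · intro h
    have := h.aeval (rowForm N) (isHomogeneous_rowForm N)
    rw [one_mul] at this
    have heq : aeval (rowForm N) (linearSubst M N hMN hNM f) = f :=
      (linearSubst M N hMN hNM).symm_apply_apply f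
    rwa [heq] at this
  · intro h
    have := h.aeval (rowForm M) (isHomogeneous_rowForm M)
    rwa [one_mul] at this

theorem eval_linearSubst (f : MvPolynomial σ K) (w : τ → K) :
    eval w (linearSubst M N hMN hNM f) = eval (M.mulVec w) f := by
  have : (aeval w).comp (aeval (rowForm M)) = aeval (M.mulVec w) := by
    ext1 a
    simp [rowForm, Matrix.mulVec, dotProduct]
  exact DFunLike.congr_fun this f

end LinearSubst

/-! ### Ideals of unions of linear subvarieties in coordinates -/

section Coordinates

variable {K : Type*} [Field K] {τ B : Type*} [DecidableEq B] {β : τ → Option B}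

theorem eval_eq_zero_of_mem_outWeight {i : B} {w : τ → K} (hw : ∀ k, β k ≠ some i → w k = 0)
    {f : MvPolynomial τ K} (hf : f ∈ weightIdeal K (outWeight β i) 1) : eval w f = 0 := by
  rw [eval_eq]
  refine Finset.sum_eq_zero fun a ha => ?_
  obtain ⟨k, hk, hak⟩ := exists_of_weight_pos (mem_weightIdeal.1 hf a ha)
  have hk' : β k ≠ some i := by
    intro h
    simp [outWeight, h] at hk
  rw [Finset.prod_eq_zero (i := k) (Finsupp.mem_support_iff.2 (by omega)), mul_zero]
  rw [hw k hk', zero_pow (by omega)]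

/-- Setting the variables outside block `i` to zero does not change `f` modulo `P i`, and the result
vanishes as a function, hence as a polynomial over an infinite field. -/
theorem mem_outWeight_of_eval_eq_zero [Infinite K] {i : B} (hp : ∃ p, β p = some i)
    {f : MvPolynomial τ K}
    (hf : ∀ w : τ → K, w ≠ 0 → (∀ k, β k ≠ some i → w k = 0) → eval w f = 0) :
    f ∈ weightIdeal K (outWeight β i) 1 := by
  obtain ⟨p, hp⟩ := hp
  let π : MvPolynomial τ K →ₐ[K] MvPolynomial τ K :=
    aeval fun k => if β k = some i then X k else 0
  have hπ : ∀ w : τ → K, eval w (π f) = eval (fun k => if β k = some i then w k else 0) f := by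
    intro w
    have : (aeval w).comp π = aeval (fun k => if β k = some i then w k else 0) := by
      ext1 k
      simp only [π, AlgHom.comp_apply, aeval_X]
      split_ifs <;> simp
    exact DFunLike.congr_fun this f
  have h0 : π f = 0 := by
    -- Vanishing is only assumed at nonzero vectors; the factor `X p` disposes of the points where
    -- the truncated vector could be zero.
    have hmul : π f * X p = 0 := by
      refine MvPolynomial.funext fun w => ?_
      rw [map_mul, hπ, eval_X, map_zero]
      by_cases hw : w p = 0
      · rw [hw, mul_zero]
      · rw [hf, zero_mul]
        · intro h
          have := congrFun h p
          simp [hp, hw] at this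
        · intro k hk
          simp [hk]
    exact (mul_eq_zero.1 hmul).resolve_right (X_ne_zero p)
  have hquot : (Ideal.Quotient.mkₐ K (weightIdeal K (outWeight β i) 1)).comp π =
      Ideal.Quotient.mkₐ K (weightIdeal K (outWeight β i) 1) := by
    ext1 k
    simp only [π, AlgHom.comp_apply, aeval_X]
    split_ifs with h
    · rfl
    · rw [map_zero, eq_comm, Ideal.Quotient.mkₐ_eq_mk, Ideal.Quotient.eq_zero_iff_mem,
        X_mem_weightIdeal, outWeight, if_neg h]
  have := DFunLike.congr_fun hquot f
  rw [AlgHom.comp_apply, h0, map_zero, eq_comm, Ideal.Quotient.mkₐ_eq_mk,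
    Ideal.Quotient.eq_zero_iff_mem] at this
  exact this

theorem projIdeal_unionSet_eq [Infinite K] {n s : ℕ} [Fintype τ] [DecidableEq τ]
    {β : τ → Option (Fin s)} (hs : 1 ≤ s) (hβ : ∀ i, ∃ p, β p = some i)
    {M : Matrix (Fin (n + 1)) τ K} {N : Matrix τ (Fin (n + 1)) K} (hMN : M * N = 1)
    (hNM : N * M = 1) {L : Fin s → PLin K n}
    (hL : ∀ i v, v ∈ Projectivization.Subspace.submodule (L i) ↔
      ∃ w : τ → K, (∀ k, β k ≠ some i → w k = 0) ∧ v = M.mulVec w) :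
    projIdeal (unionSet L) = (blockIdeal K β).comap (linearSubst M N hMN hNM) := by
  have : Nonempty (Fin s) := ⟨⟨0, hs⟩⟩
  set e := linearSubst M N hMN hNM with he
  apply le_antisymm
  · rw [projIdeal, Ideal.span_le]
    rintro f ⟨-, hf⟩
    rw [SetLike.mem_coe, Ideal.mem_comap, blockIdeal_eq_iInf, Submodule.mem_iInf]
    intro i
    refine mem_outWeight_of_eval_eq_zero (hβ i) fun w hw hwi => ?_
    have hne : M.mulVec w ≠ 0 := by
      intro h
      apply hw
      rw [← Matrix.one_mulVec w, ← hNM, ← Matrix.mulVec_mulVec, h, Matrix.mulVec_zero]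
    rw [he, eval_linearSubst]
    refine hf _ hne (Set.mem_iUnion.2 ⟨i, ?_⟩)
    exact (Projectivization.Subspace.mem_submodule_iff _ hne).1 ((hL i _).2 ⟨w, hwi, rfl⟩)
  · have hmap : (blockIdeal K β).comap e = (blockIdeal K β).map e.symm :=
      Ideal.comap_symm (I := blockIdeal K β) e.toRingEquiv.symm
    rw [hmap, blockIdeal, Ideal.map_span, Ideal.span_le]
    rintro _ ⟨_, ⟨a, ha, rfl⟩, rfl⟩
    refine Ideal.subset_span ⟨⟨a.degree, ?_⟩, fun v hv hvX => ?_⟩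
    · rw [← isHomogeneous_linearSubst hMN hNM, ← he]
      simpa using isHomogeneous_monomial (1 : K) (d := a) rfl
    · obtain ⟨i, hi⟩ := Set.mem_iUnion.1 hvX
      obtain ⟨w, hw, rfl⟩ :=
        (hL i v).1 ((Projectivization.Subspace.mem_submodule_iff _ hv).2 hi)
      rw [← eval_linearSubst hMN hNM, ← he]
      have : eval w (monomial a (1 : K)) = 0 :=
        eval_eq_zero_of_mem_outWeight hw (blockIdeal_le_outWeight i (monomial_mem_blockIdeal ha))
      simpa using this

end Coordinates

/-! ### General position -/

section GeneralPosition

variable {K : Type*} [Field K] {n s t : ℕ}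

theorem submodule_iSup_mem (L : Fin s → PLin K n) (S : Finset (Fin s)) :
    Projectivization.Subspace.submodule (⨆ i ∈ S, L i) =
      ⨆ i ∈ S, Projectivization.Subspace.submodule (L i) := by
  rw [OrderIso.map_iSup]
  exact iSup_congr fun i => by rw [OrderIso.map_iSup]

/-- Linear subvarieties in general position whose dimensions are small are the spans of disjoint
parts of a basis. -/
theorem exists_basis (hst : s * t ≤ n + 1) (L : Fin s → PLin K n) (hL : ∀ i, coneDim (L i) = t)
    (hgen : InGeneralPosition L) :
    ∃ (ι : Set (Fin (n + 1) → K)) (_ : Fintype ι)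
      (b : Module.Basis ((Fin s × Fin t) ⊕ ι) K (Fin (n + 1) → K)),
      ∀ i, Projectivization.Subspace.submodule (L i) =
        Submodule.span K (Set.range fun j : Fin t => b (Sum.inl (i, j))) := by
  let V := fun i => Projectivization.Subspace.submodule (L i)
  let c : ∀ i, Module.Basis (Fin t) K (V i) := fun i =>
    Module.finBasisOfFinrankEq K (V i) (hL i)
  let v : Fin s × Fin t → Fin (n + 1) → K := fun p => (c p.1 p.2 : Fin (n + 1) → K)
  have hspan : ∀ i, Submodule.span K (Set.range fun j => v (i, j)) = V i := by
    intro i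
    have h := congrArg (Submodule.map (V i).subtype) (c i).span_eq
    rw [Submodule.map_span, ← Set.range_comp, Submodule.map_top, Submodule.range_subtype] at h
    exact h
  have htot : Submodule.span K (Set.range v) = ⨆ i, V i := by
    have hr : Set.range v = ⋃ i, Set.range fun j => v (i, j) := by
      ext x
      simp
    rw [hr, Submodule.span_iUnion]
    exact iSup_congr hspan
  have hlin : LinearIndependent K v := by
    -- General position of the full family says that these `s * t` vectors span a space of dimension
    -- `min (n + 1) (s * t) = s * t`.
    rw [linearIndependent_iff_card_eq_finrank_span, Set.finrank, htot]
    have h := hgen Finset.univ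
    have hU : (⨆ i ∈ Finset.univ, Projectivization.Subspace.submodule (L i)) = ⨆ i, V i :=
      iSup_congr fun i => iSup_pos (Finset.mem_univ i)
    rw [coneDim, submodule_iSup_mem, hU] at h
    simp only [hL, Finset.sum_const, Finset.card_univ,
      Fintype.card_fin, smul_eq_mul] at h
    rw [h, Fintype.card_prod, Fintype.card_fin, Fintype.card_fin, min_eq_right hst]
  have hb : ∀ p, Module.Basis.sumExtend hlin (Sum.inl p) = v p := by
    intro p
    simp only [Module.Basis.sumExtend, Module.Basis.reindex_apply, Module.Basis.coe_extend]
    rfl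
  have : Finite ((Fin s × Fin t) ⊕ Module.Basis.sumExtendIndex hlin) :=
    Module.Finite.finite_basis (Module.Basis.sumExtend hlin)
  have : Finite (Module.Basis.sumExtendIndex hlin) :=
    Finite.of_injective (Sum.inr (α := Fin s × Fin t)) Sum.inr_injective
  refine ⟨_, Fintype.ofFinite _, Module.Basis.sumExtend hlin, fun i => ?_⟩
  simp only [hb]
  exact (hspan i).symm

theorem generalPosition_of_linearIndependent (hst : s * t ≤ n + 1)
    {A : Fin s → Fin t → Fin (n + 1) → K}
    (hA : LinearIndependent K fun p : Fin s × Fin t => A p.1 p.2) :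
    (∀ i, coneDim (linearSpan (A i)) = t) ∧ InGeneralPosition fun i => linearSpan (A i) := by
  have hsub : ∀ i, Projectivization.Subspace.submodule (linearSpan (A i)) =
      Submodule.span K (Set.range (A i)) := fun i => OrderIso.apply_symm_apply _ _
  have hdim : ∀ i, coneDim (linearSpan (A i)) = t := by
    intro i
    rw [coneDim, hsub]
    have := finrank_span_eq_card (hA.comp (fun j : Fin t => (i, j)) fun j j' h => by simpa using h)
    simpa [Function.comp_def] using this
  refine ⟨hdim, fun S => ?_⟩
  rw [coneDim, submodule_iSup_mem]
  simp only [hdim]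
  have hr : (⨆ i ∈ S, Projectivization.Subspace.submodule (linearSpan (A i))) =
      Submodule.span K (Set.range fun p : S × Fin t => A p.1 p.2) := by
    have : (Set.range fun p : S × Fin t => A p.1 p.2) = ⋃ i ∈ S, Set.range (A i) := by
      ext x
      simp
    simp_rw [this, Submodule.span_iUnion₂, hsub]
  have hind : LinearIndependent K fun p : S × Fin t => A p.1 p.2 := by
    refine hA.comp (fun p : S × Fin t => ((p.1 : Fin s), p.2)) ?_
    rintro ⟨⟨i, hi⟩, j⟩ ⟨⟨i', hi'⟩, j'⟩ h
    simpa using h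
  have hle : S.card * t ≤ n + 1 :=
    (Nat.mul_le_mul_right t (by simpa using S.card_le_univ)).trans hst
  rw [hr, finrank_span_eq_card hind]
  simp [hle]

/-- `F` is an `s * t` minor of the generic matrix of coordinates, with columns selected by `φ`; it
is nonzero because it specializes to the determinant of the identity. -/
theorem exists_generic (K : Type*) [Field K] (hst : s * t ≤ n + 1) :
    ∃ F : MvPolynomial (Fin s × Fin t × Fin (n + 1)) K, F ≠ 0 ∧
      ∀ A : Fin s → Fin t → Fin (n + 1) → K,
        eval (fun p => A p.1 p.2.1 p.2.2) F ≠ 0 →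
          LinearIndependent K fun p : Fin s × Fin t => A p.1 p.2 := by
  obtain ⟨φ⟩ : Nonempty (Fin s × Fin t ↪ Fin (n + 1)) :=
    Function.Embedding.nonempty_of_card_le (by simpa using hst)
  let G : Matrix (Fin s × Fin t) (Fin s × Fin t)
      (MvPolynomial (Fin s × Fin t × Fin (n + 1)) K) :=
    Matrix.of fun p q => X (p.1, p.2, φ q)
  have heval : ∀ A : Fin s → Fin t → Fin (n + 1) → K,
      eval (fun p => A p.1 p.2.1 p.2.2) G.det =
        (Matrix.of fun p q : Fin s × Fin t => A p.1 p.2 (φ q)).det := by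
    intro A
    rw [RingHom.map_det]
    congr 1
    ext p q
    simp [G]
  refine ⟨G.det, fun h => ?_, fun A hA => ?_⟩
  · have := heval fun i j k => if φ (i, j) = k then 1 else 0
    have hone : (Matrix.of fun p q : Fin s × Fin t =>
        if φ (p.1, p.2) = φ q then (1 : K) else 0) = 1 := by
      ext p q
      simp [Matrix.one_apply]
    rw [h, hone] at this
    simp at this
  · rw [heval] at hA
    have h := Matrix.linearIndependent_rows_of_det_ne_zero hA
    exact LinearIndependent.of_comp (LinearMap.funLeft K K φ) h

end GeneralPosition

/-! ### Resurgences and Waldschmidt constants from the structure of the powers -/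

theorem tendsto_resurgence_bound {s : ℕ} (hs : 2 ≤ s) :
    Tendsto (fun j : ℕ => ((2 * (s - 1) * (j + 1) : ℕ) : ℝ) / ((s * (j + 1) + 1 : ℕ) : ℝ)) atTop
      (𝓝 (2 * ((s : ℝ) - 1) / (s : ℝ))) := by
  have hs0 : (s : ℝ) ≠ 0 := by positivity
  have h1 : Tendsto (fun j : ℕ => 1 / ((j : ℝ) + 1)) atTop (𝓝 0) :=
    tendsto_one_div_add_atTop_nhds_zero_nat
  have h2 : Tendsto (fun j : ℕ => 2 * ((s : ℝ) - 1) / ((s : ℝ) + 1 / ((j : ℝ) + 1))) atTop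
      (𝓝 (2 * ((s : ℝ) - 1) / ((s : ℝ) + 0))) :=
    tendsto_const_nhds.div (tendsto_const_nhds.add h1) (by simpa using hs0)
  rw [add_zero] at h2
  refine h2.congr fun j => ?_
  have hj : (j : ℝ) + 1 ≠ 0 := by positivity
  have hsj : (s : ℝ) * (j + 1) + 1 ≠ 0 := by positivity
  have hsj' : (s : ℝ) + 1 / (j + 1) ≠ 0 := by positivity
  push_cast [Nat.cast_sub (show 1 ≤ s by omega)]
  rw [div_eq_div_iff hsj' hsj]
  field_simp

section

variable {K σ : Type*} [Field K] {I : Ideal (MvPolynomial σ K)} {s : ℕ}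

/-- `hle` bounds both suprema from above, and the ratios from `hnot` tend to that bound. Using `j +
1` for `j` keeps the symbolic exponent positive. -/
theorem resurgence_eq (hs : 2 ≤ s)
    (hle : ∀ m r, ¬ symbolicPower I m ≤ I ^ r → s * m ≤ 2 * (s - 1) * r)
    (hnot : ∀ j k, 0 < k → ¬ symbolicPower I (2 * (s - 1) * j * k) ≤ I ^ ((s * j + 1) * k)) :
    resurgence I = 2 * ((s : ℝ) - 1) / (s : ℝ) ∧
      asymptoticResurgence I = 2 * ((s : ℝ) - 1) / (s : ℝ) := by
  have hs0 : (0 : ℝ) < s := by positivity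
  have hub : ∀ m r : ℕ, 0 < r → ¬ symbolicPower I m ≤ I ^ r →
      (m : ℝ) / r ≤ 2 * ((s : ℝ) - 1) / (s : ℝ) := by
    intro m r hr h
    have h1 : ((s * m : ℕ) : ℝ) ≤ ((2 * (s - 1) * r : ℕ) : ℝ) := by exact_mod_cast hle m r h
    push_cast [Nat.cast_sub (show 1 ≤ s by omega)] at h1
    rw [div_le_div_iff₀ (by exact_mod_cast hr) hs0]
    linarith
  have hpos : ∀ j, 0 < 2 * (s - 1) * (j + 1) := fun j =>
    Nat.mul_pos (Nat.mul_pos two_pos (by omega)) j.succ_pos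
  constructor
  · have hbdd : ∀ q ∈ {q : ℝ | ∃ m r : ℕ, 0 < m ∧ 0 < r ∧ q = (m : ℝ) / (r : ℝ) ∧
        ¬ symbolicPower I m ≤ I ^ r}, q ≤ 2 * ((s : ℝ) - 1) / (s : ℝ) := by
      rintro q ⟨m, r, -, hr, rfl, h⟩
      exact hub m r hr h
    have hmem : ∀ j : ℕ, ((2 * (s - 1) * (j + 1) : ℕ) : ℝ) / ((s * (j + 1) + 1 : ℕ) : ℝ) ∈
        {q : ℝ | ∃ m r : ℕ, 0 < m ∧ 0 < r ∧ q = (m : ℝ) / (r : ℝ) ∧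
          ¬ symbolicPower I m ≤ I ^ r} := fun j =>
      ⟨_, _, hpos j, Nat.succ_pos _, rfl, by simpa using hnot (j + 1) 1 one_pos⟩
    exact le_antisymm (csSup_le ⟨_, hmem 0⟩ hbdd)
      (le_of_tendsto' (tendsto_resurgence_bound hs) fun j => le_csSup ⟨_, hbdd⟩ (hmem j))
  · have hbdd : ∀ q ∈ {q : ℝ | ∃ m r : ℕ, 0 < m ∧ 0 < r ∧ q = (m : ℝ) / (r : ℝ) ∧
        ∀ᶠ t : ℕ in atTop, ¬ symbolicPower I (m * t) ≤ I ^ (r * t)},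
        q ≤ 2 * ((s : ℝ) - 1) / (s : ℝ) := by
      rintro q ⟨m, r, -, hr, rfl, h⟩
      obtain ⟨k, hk, hk0⟩ := (h.and (eventually_gt_atTop 0)).exists
      have := hub (m * k) (r * k) (Nat.mul_pos hr hk0) hk
      push_cast at this
      rwa [mul_div_mul_right _ _ (by positivity)] at this
    have hmem : ∀ j : ℕ, ((2 * (s - 1) * (j + 1) : ℕ) : ℝ) / ((s * (j + 1) + 1 : ℕ) : ℝ) ∈
        {q : ℝ | ∃ m r : ℕ, 0 < m ∧ 0 < r ∧ q = (m : ℝ) / (r : ℝ) ∧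
          ∀ᶠ t : ℕ in atTop, ¬ symbolicPower I (m * t) ≤ I ^ (r * t)} := fun j =>
      ⟨_, _, hpos j, Nat.succ_pos _, rfl,
        (eventually_gt_atTop 0).mono fun k hk => hnot (j + 1) k hk⟩
    exact le_antisymm (csSup_le ⟨_, hmem 0⟩ hbdd)
      (le_of_tendsto' (tendsto_resurgence_bound hs) fun j => le_csSup ⟨_, hbdd⟩ (hmem j))

theorem tendsto_waldschmidtSeq_one (h : ∀ m, initialDegree (symbolicPower I m) = m) :
    Tendsto (waldschmidtSeq I) atTop (𝓝 1) := by
  refine tendsto_const_nhds.congr' ((eventually_gt_atTop 0).mono fun m hm => ?_)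
  rw [waldschmidtSeq, h, div_self]
  positivity

theorem tendsto_waldschmidtSeq_of_bounds (hs : 2 ≤ s)
    (hlow : ∀ m, s * m ≤ (s - 1) * initialDegree (symbolicPower I m))
    (hup : ∀ m c, m ≤ (s - 1) * c → initialDegree (symbolicPower I m) ≤ s * c) :
    Tendsto (waldschmidtSeq I) atTop (𝓝 ((s : ℝ) / ((s : ℝ) - 1))) := by
  have hs1 : (0 : ℝ) < (s : ℝ) - 1 := by
    have : (2 : ℝ) ≤ s := by exact_mod_cast hs
    linarith
  have hlim : Tendsto (fun m : ℕ => (s : ℝ) / ((s : ℝ) - 1) + (s : ℝ) / (m : ℝ)) atTop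
      (𝓝 ((s : ℝ) / ((s : ℝ) - 1))) := by
    simpa using (tendsto_const_nhds (x := (s : ℝ) / ((s : ℝ) - 1))).add
      (tendsto_const_div_atTop_nhds_zero_nat (s : ℝ))
  refine tendsto_of_tendsto_of_tendsto_of_le_of_le' tendsto_const_nhds hlim
    ((eventually_gt_atTop 0).mono fun m hm => ?_) ((eventually_gt_atTop 0).mono fun m hm => ?_)
  · have hm0 : (0 : ℝ) < m := by exact_mod_cast hm
    have h1 : ((s * m : ℕ) : ℝ) ≤ (((s - 1) * initialDegree (symbolicPower I m) : ℕ) : ℝ) := by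
      exact_mod_cast hlow m
    push_cast [Nat.cast_sub (show 1 ≤ s by omega)] at h1
    rw [waldschmidtSeq, div_le_div_iff₀ hs1 hm0]
    linarith
  · have hm0 : (0 : ℝ) < m := by exact_mod_cast hm
    -- The rounding in `c = m / (s - 1) + 1` costs at most `s` in degree, hence the error term `s /
    -- m`.
    have hc : m ≤ (s - 1) * (m / (s - 1) + 1) :=
      (Nat.lt_mul_div_succ m (show 0 < s - 1 by omega)).le
    have h1 : (initialDegree (symbolicPower I m) : ℝ) ≤ ((s * (m / (s - 1) + 1) : ℕ) : ℝ) := by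
      exact_mod_cast hup m _ hc
    have h2 : ((m / (s - 1) : ℕ) : ℝ) ≤ (m : ℝ) / ((s : ℝ) - 1) := by
      have := Nat.cast_div_le (α := ℝ) (m := m) (n := s - 1)
      rwa [Nat.cast_sub (show 1 ≤ s by omega), Nat.cast_one] at this
    rw [waldschmidtSeq, div_le_iff₀ hm0]
    push_cast at h1
    calc (initialDegree (symbolicPower I m) : ℝ)
        ≤ s * ((m / (s - 1) : ℕ) + 1) := h1
      _ ≤ s * ((m : ℝ) / ((s : ℝ) - 1) + 1) := by gcongr
      _ = ((s : ℝ) / ((s : ℝ) - 1) + (s : ℝ) / (m : ℝ)) * m := by field_simp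

end

/-! ### Unions of linear subvarieties in general position -/

/-- The block of a coordinate: the first summand holds the coordinates of the linear
subvarieties. -/
def blockOf {B J ι : Type*} : (B × J) ⊕ ι → Option B :=
  Sum.elim (fun p => some p.1) fun _ => none

theorem mem_span_iff_mulVec {K : Type*} [Field K] {n s t : ℕ} {ι : Type*} [Fintype ι]
    [DecidableEq ι] (b : Module.Basis ((Fin s × Fin t) ⊕ ι) K (Fin (n + 1) → K)) (i : Fin s)
    (v : Fin (n + 1) → K) :
    v ∈ Submodule.span K (Set.range fun j : Fin t => b (Sum.inl (i, j))) ↔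
      ∃ w : (Fin s × Fin t) ⊕ ι → K, (∀ k, blockOf k ≠ some i → w k = 0) ∧
        v = ((Pi.basisFun K (Fin (n + 1))).toMatrix b).mulVec w := by
  have hM : ∀ w, ((Pi.basisFun K (Fin (n + 1))).toMatrix b).mulVec w = ∑ k, w k • b k := by
    intro w
    ext a
    simp [Matrix.mulVec, dotProduct, Module.Basis.toMatrix_apply, mul_comm]
  constructor
  · intro h
    obtain ⟨c, rfl⟩ := (Submodule.mem_span_range_iff_exists_fun K).1 h
    refine ⟨Sum.elim (fun p => if p.1 = i then c p.2 else 0) 0, ?_, ?_⟩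
    · rintro (⟨i', j⟩ | x) hk
      · have : i' ≠ i := by simpa [blockOf] using hk
        simp [this]
      · rfl
    · rw [hM, Fintype.sum_sum_type, Fintype.sum_prod_type]
      simp [ite_smul, Finset.sum_ite_irrel]
  · rintro ⟨w, hw, rfl⟩
    rw [hM]
    refine Submodule.sum_mem _ fun k _ => ?_
    by_cases hk : blockOf k = some i
    · rcases k with ⟨i', j⟩ | x
      · obtain rfl : i' = i := by simpa [blockOf] using hk
        exact Submodule.smul_mem _ _ (Submodule.subset_span ⟨j, rfl⟩)
      · simp [blockOf] at hk
    · rw [hw k hk, zero_smul]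
      exact Submodule.zero_mem _

theorem exists_coordinates {K : Type*} [Field K] [Infinite K] {n s t : ℕ} (hs : 1 ≤ s)
    (ht : 1 ≤ t) (hst : s * t ≤ n + 1) (L : Fin s → PLin K n) (hL : ∀ i, coneDim (L i) = t)
    (hgen : InGeneralPosition L) :
    ∃ (ι : Set (Fin (n + 1) → K)) (_ : Fintype ι)
      (e : MvPolynomial (Fin (n + 1)) K ≃ₐ[K] MvPolynomial ((Fin s × Fin t) ⊕ ι) K),
      s * t + Fintype.card ι = n + 1 ∧
      (∀ f d, (e f).IsHomogeneous d ↔ f.IsHomogeneous d) ∧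
      projIdeal (unionSet L) = (blockIdeal K blockOf).comap e := by
  classical
  obtain ⟨ι, hι, b, hb⟩ := exists_basis hst L hL hgen
  have hMN := (Pi.basisFun K (Fin (n + 1))).toMatrix_mul_toMatrix_flip b
  have hNM := b.toMatrix_mul_toMatrix_flip (Pi.basisFun K (Fin (n + 1)))
  refine ⟨ι, hι, linearSubst _ _ hMN hNM, ?_, isHomogeneous_linearSubst hMN hNM,
    projIdeal_unionSet_eq hs (fun i => ⟨Sum.inl (i, ⟨0, ht⟩), rfl⟩) hMN hNM fun i v => ?_⟩
  · have := Module.finrank_eq_card_basis b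
    simpa using this.symm
  · rw [hb]
    exact mem_span_iff_mulVec b i v

end LinearUnion

end

theorem mainTheorem7 (K : Type*) [Field K] [IsAlgClosed K] (n s t : ℕ)
    (hs : 1 ≤ s) (ht : 1 ≤ t) (htn : t ≤ n) (hst : s * t ≤ n + 1) :
    -- the linear subvarieties spanned by general vectors have dimension `t - 1` and are in
    -- general position
    (∃ F : MvPolynomial (Fin s × Fin t × Fin (n + 1)) K, F ≠ 0 ∧
      ∀ A : Fin s → Fin t → Fin (n + 1) → K,
        MvPolynomial.eval (fun p => A p.1 p.2.1 p.2.2) F ≠ 0 →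
          (∀ i, LinearUnion.coneDim (LinearUnion.linearSpan (A i)) = t) ∧
            LinearUnion.InGeneralPosition (fun i => LinearUnion.linearSpan (A i))) ∧
    -- the invariants of every such union
    ∀ L : Fin s → LinearUnion.PLin K n,
      (∀ i, LinearUnion.coneDim (L i) = t) → LinearUnion.InGeneralPosition L →
      ∀ I : Ideal (MvPolynomial (Fin (n + 1)) K),
        I = LinearUnion.projIdeal (LinearUnion.unionSet L) →
        Tendsto (LinearUnion.waldschmidtSeq I) atTop (𝓝 (LinearUnion.waldschmidt I)) ∧
        (s * t < n + 1 → LinearUnion.waldschmidt I = 1) ∧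
        (s * t = n + 1 → LinearUnion.waldschmidt I = ((n : ℝ) + 1) / ((n : ℝ) + 1 - (t : ℝ))) ∧
        (2 ≤ s →
          LinearUnion.resurgence I = 2 * ((s : ℝ) - 1) / (s : ℝ) ∧
          LinearUnion.asymptoticResurgence I = 2 * ((s : ℝ) - 1) / (s : ℝ)) ∧
        (s * t = n + 1 →
          (LinearUnion.initialDegree I : ℝ) / LinearUnion.waldschmidt I
              = LinearUnion.asymptoticResurgence I ∧
          LinearUnion.asymptoticResurgence I = LinearUnion.resurgence I ∧
          LinearUnion.resurgence I
              = (LinearUnion.maxGeneratorDegree I : ℝ) / LinearUnion.waldschmidt I) ∧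
        (s * t ≤ n → 3 ≤ s →
          (LinearUnion.initialDegree I : ℝ) / LinearUnion.waldschmidt I
              < LinearUnion.asymptoticResurgence I ∧
          LinearUnion.asymptoticResurgence I = LinearUnion.resurgence I ∧
          LinearUnion.resurgence I
              < (LinearUnion.maxGeneratorDegree I : ℝ) / LinearUnion.waldschmidt I) := by
  open LinearUnion in
  constructor
  · obtain ⟨F, hF, hA⟩ := exists_generic K hst
    exact ⟨F, hF, fun A h => generalPosition_of_linearIndependent hst (hA A h)⟩
  intro L hL hgen I hI
  classical
  have : Infinite K := IsAlgClosed.instInfinite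
  have : Nonempty (Fin s) := ⟨⟨0, hs⟩⟩
  obtain ⟨ι, _, e, hcard, he, hJ⟩ := exists_coordinates hs ht hst L hL hgen
  rw [hJ] at hI
  set β : (Fin s × Fin t) ⊕ ι → Option (Fin s) := blockOf with hβdef
  have hβ : ∀ i, ∃ p, β p = some i := fun i => ⟨Sum.inl (i, ⟨0, ht⟩), rfl⟩
  have hsymb : ∀ m, symbolicPower I m = (blockSymbolic K β m).comap e := fun m => by
    rw [hI, symbolicPower_comap_blockIdeal hβ]
  have hcont : ∀ m r, symbolicPower I m ≤ I ^ r ↔ blockSymbolic K β m ≤ blockIdeal K β ^ r := by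
    intro m r
    rw [hsymb, hI, ← comap_pow_algEquiv, comap_le_comap_algEquiv]
  have hdeg : ∀ m, initialDegree (symbolicPower I m) = initialDegree (blockSymbolic K β m) :=
    fun m => by rw [hsymb, initialDegree_comap he]
  have hs_card : Fintype.card (Fin s) = s := Fintype.card_fin s
  have hres : 2 ≤ s → resurgence I = 2 * ((s : ℝ) - 1) / (s : ℝ) ∧
      asymptoticResurgence I = 2 * ((s : ℝ) - 1) / (s : ℝ) := by
    intro hs2
    refine resurgence_eq hs2 (fun m r h => ?_) fun j k hk h => ?_
    · rw [hcont] at h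
      simpa using card_mul_le_of_not_blockSymbolic_le (by simpa using hs2) h
    · rw [hcont] at h
      refine not_blockSymbolic_le (K := K) hβ j hk ?_
      simpa using h
  have hmax : 2 ≤ s → maxGeneratorDegree I = 2 := by
    intro hs2
    rw [hI, maxGeneratorDegree_comap he]
    exact maxGeneratorDegree_blockIdeal ⟨Sum.inl (⟨0, hs⟩, ⟨0, ht⟩), Sum.inl (⟨1, hs2⟩, ⟨0, ht⟩),
      _, _, by simp, rfl, rfl⟩
  have hsmall : s * t < n + 1 → Tendsto (waldschmidtSeq I) atTop (𝓝 1) ∧ initialDegree I = 1 := by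
    intro hlt
    obtain ⟨x⟩ : Nonempty ι := Fintype.card_pos_iff.1 (by omega)
    have hnone : ∃ k, β k = none := ⟨Sum.inr x, rfl⟩
    refine ⟨tendsto_waldschmidtSeq_one fun m => ?_, ?_⟩
    · rw [hdeg, initialDegree_blockSymbolic_of_none hnone]
    · rw [hI, initialDegree_comap he, ← blockSymbolic_one,
        initialDegree_blockSymbolic_of_none hnone]
  have hlarge : s * t = n + 1 → 2 ≤ s ∧
      Tendsto (waldschmidtSeq I) atTop (𝓝 ((s : ℝ) / ((s : ℝ) - 1))) ∧ initialDegree I = 2 := by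
    intro heq
    -- With `s = 1` the equality would force `t = n + 1`, against `t ≤ n`.
    have hs2 : 2 ≤ s := by
      by_contra! h
      obtain rfl : s = 1 := by omega
      omega
    have hempty : IsEmpty ι := Fintype.card_eq_zero_iff.1 (by omega)
    have hnone : ∀ k, β k ≠ none := by
      rintro (p | x)
      · simp [hβdef, blockOf]
      · exact hempty.elim x
    have hB : 2 ≤ Fintype.card (Fin s) := by rwa [hs_card]
    refine ⟨hs2, tendsto_waldschmidtSeq_of_bounds hs2 (fun m => ?_) fun m c hc => ?_, ?_⟩
    · rw [hdeg]
      simpa using card_mul_le_initialDegree_blockSymbolic (K := K) hB hβ hnone m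
    · rw [hdeg]
      simpa using initialDegree_blockSymbolic_le (K := K) hβ (m := m) (c := c) (by simpa using hc)
    · rw [hI, initialDegree_comap he, initialDegree_blockIdeal hB hβ hnone]
  refine ⟨?_, fun h => (hsmall h).1.limUnder_eq, fun h => ?_, hres, fun h => ?_, fun h hs3 => ?_⟩
  · rcases hst.lt_or_eq with h | h
    · rw [waldschmidt, (hsmall h).1.limUnder_eq]
      exact (hsmall h).1
    · rw [waldschmidt, (hlarge h).2.1.limUnder_eq]
      exact (hlarge h).2.1
  · obtain ⟨hs2, hT, -⟩ := hlarge h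
    have hs2' : (2 : ℝ) ≤ s := by exact_mod_cast hs2
    have ht0 : (t : ℝ) ≠ 0 := by positivity
    have hn : (n : ℝ) + 1 = s * t := by exact_mod_cast h.symm
    rw [waldschmidt, hT.limUnder_eq, hn]
    have h3 : (s : ℝ) * t - t = (s - 1) * t := by ring
    rw [h3, mul_div_mul_right _ _ ht0]
  · obtain ⟨hs2, hT, hα⟩ := hlarge h
    obtain ⟨h1, h2⟩ := hres hs2
    have hs2' : (2 : ℝ) ≤ s := by exact_mod_cast hs2
    have hw : waldschmidt I = (s : ℝ) / ((s : ℝ) - 1) := hT.limUnder_eq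
    rw [h1, h2, hα, hmax hs2, hw, Nat.cast_ofNat, div_div_eq_mul_div]
    exact ⟨rfl, rfl, rfl⟩
  · obtain ⟨hT, hα⟩ := hsmall (by omega)
    obtain ⟨h1, h2⟩ := hres (by omega)
    have hs3' : (3 : ℝ) ≤ s := by exact_mod_cast hs3
    have hw : waldschmidt I = 1 := hT.limUnder_eq
    rw [h1, h2, hα, hmax (by omega), hw]
    -- The claims are `1 < 2 * (s - 1) / s`, which is where `3 ≤ s` enters, and `2 * (s - 1) / s <
    -- 2`.
    refine ⟨?_, rfl, ?_⟩
    · rw [Nat.cast_one, div_one, lt_div_iff₀ (by positivity)]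
      linarith
    · rw [Nat.cast_ofNat, div_one, div_lt_iff₀ (by positivity)]
      linarith
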